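/- Let $u^+,u^-:\mathbb R\to\mathbb R_{\ge 0}$ be continuous, with $u^+=0$ on $(-\infty,0]$ and non-decreasing on $(0,\infty)$, and $u^-=0$ on $[0,\infty)$ and non-increasing on $(-\infty,0)$. Let $w^+,w^-:[0,1]\to[0,1]$ be Lipschitz continuous and non-decreasing with $w^\pm(0)=0$ and $w^\pm(1)=1$. The CPT-value of a bounded random variable $Y$ is $$\rho_{cpt}(Y)=\int_0^\infty w^+\big(\mathbb P(u^+(Y)>z)\big)\,dz-\int_0^\infty w^-\big(\mathbb P(u^-(Y)>z)\big)\,dz .$$ Consider a Markov decision process with finite state space $S$, finite action space $A$, an initial distribution, transition probabilities $\mathbb P(s'|s,a)$, discount factor $\gamma\in(0,1]$, and costs $c(s,a)$ that are (possibly constant) random variables, where the cost $c(s,a)$ and the next state $s'\sim\mathbb P(\cdot|s,a)$ may have any joint law. Assume that the costs are bounded. Let $\pi(\cdot|s)$ be a policy, that is, a probability distribution on $A$ for every $s\in S$. For $Q:S\times A\to\mathbb R$ let $Y_Q(s,a)$ be the random variable $$Y_Q(s,a)=c(s,a)+\gamma\sum_{a'}\pi(a'|s')Q(s',a'),\qquad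 s'\sim\mathbb P(\cdot|s,a),$$ or, alternatively, for all $Q,s,a$ at once, the random variable $$Y_Q(s,a)=c(s,a)+\gamma\sum_{s'}\mathbb P(s'|s,a)\sum_{a'}\pi(a'|s')Q(s',a');$$ the claim holds for either choice. Define the CPT-Q-iteration operator by $(\mathcal T_\pi Q)(s,a)=\rho_{cpt}(Y_Q(s,a))$ and assume that $\mathcal T_\pi$ is a contraction for the norm $\max_{s,a}|Q(s,a)|$, that is, Lipschitz with a constant smaller than $1$. Let the (possibly random) learning rates $\alpha_k(s,a)\in[0,1]$, $k\ge 0$, satisfy, almost surely and for all $(s,a)$, $\sum_k\alpha_k(s,a)=\infty$ and $\sum_k\alpha_k(s,a)^2<\infty$; here $\alpha_k(s,a)=0$ means that the pair $(s,a)$ is not updated at step $k$. Starting from an arbitrary (possibly random) $Q^0$, define the asynchronous iteration $$Q^{k+1}(s,a)=(1-\alpha_k(s,a))\,Q^k(s,a)+\alpha_k(s,a)\,\rho_{cpt}\big(Y_{Q^k}(s,a)\big),$$ where $\rho_{cpt}$ is taken with $Q^k$ held fixed. Then $\mathcal T_\pi$ has a unique fixed point $Q^*_{cpt}$, and, with probability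 one, $Q^k(s,a)\to Q^*_{cpt}(s,a)$ for every $(s,a)$. -/

import Mathlib

open MeasureTheory Filter Topology

noncomputable section

namespace CPT

/-- The gain and loss utility functions `u⁺`, `u⁻` and the probability weighting functions
`w⁺`, `w⁻` of cumulative prospect theory. Only the values of the weighting functions on `[0, 1]`
matter. -/
structure Preference where
  uPos : ℝ → ℝ
  uNeg : ℝ → ℝ
  wPos : ℝ → ℝ
  wNeg : ℝ → ℝ
  uPos_continuous : Continuous uPos
  uNeg_continuous : Continuous uNeg
  uPos_nonneg : ∀ x, 0 ≤ uPos x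
  uNeg_nonneg : ∀ x, 0 ≤ uNeg x
  uPos_eq_zero : ∀ x, x ≤ 0 → uPos x = 0
  uNeg_eq_zero : ∀ x, 0 ≤ x → uNeg x = 0
  uPos_mono : MonotoneOn uPos (Set.Ioi 0)
  uNeg_anti : AntitoneOn uNeg (Set.Iio 0)
  wPos_mapsTo : Set.MapsTo wPos (Set.Icc 0 1) (Set.Icc 0 1)
  wNeg_mapsTo : Set.MapsTo wNeg (Set.Icc 0 1) (Set.Icc 0 1)
  wPos_lipschitz : ∃ L, LipschitzOnWith L wPos (Set.Icc 0 1)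
  wNeg_lipschitz : ∃ L, LipschitzOnWith L wNeg (Set.Icc 0 1)
  wPos_mono : MonotoneOn wPos (Set.Icc 0 1)
  wNeg_mono : MonotoneOn wNeg (Set.Icc 0 1)
  wPos_zero : wPos 0 = 0
  wNeg_zero : wNeg 0 = 0
  wPos_one : wPos 1 = 1
  wNeg_one : wNeg 1 = 1

/-- The CPT-value `ρ(Y) = ∫₀^∞ w⁺(P(u⁺(Y) > z)) dz - ∫₀^∞ w⁻(P(u⁻(Y) > z)) dz` of a random
variable `Y` on the probability space `(Ω, P)`. For an essentially bounded `Y`, the only case used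
below, both integrands are monotone, bounded and vanish for large `z`, and the utilities of `Y`
have finite first moments. -/
def Preference.value (U : Preference) {Ω : Type*} [MeasurableSpace Ω] (P : Measure Ω)
    (Y : Ω → ℝ) : ℝ :=
  (∫ z in Set.Ioi (0 : ℝ), U.wPos (P.real {ω | z < U.uPos (Y ω)})) -
    ∫ z in Set.Ioi (0 : ℝ), U.wNeg (P.real {ω | z < U.uNeg (Y ω)})

/-- A Markov decision process with state space `S`, action space `A` and random costs. -/
structure MDP (S A : Type*) [MeasurableSpace S] where
  /-- the distribution of the initial state -/
  init : PMF S
  /-- `trans s a s'` is the probability of moving to `s'` when `a` is taken in `s` -/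
  trans : S → A → PMF S
  /-- the joint law of the random cost `c(s, a)` and of the next state, when `a` is taken in `s`;
  a deterministic cost is the case where the first marginal is a Dirac mass -/
  outcome : S → A → Measure (ℝ × S)
  isProbabilityMeasure_outcome : ∀ s a, IsProbabilityMeasure (outcome s a)
  /-- the next state is distributed according to `trans` -/
  outcome_snd : ∀ s a, (outcome s a).map Prod.snd = (trans s a).toMeasure
  /-- the discount factor -/
  γ : ℝ
  γ_pos : 0 < γ
  γ_le_one : γ ≤ 1

/-- The two ways in which the next state `s'` can enter the random variable whose CPT-value is
taken: as a random state (`random`), so that this variable is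
`c(s, a) + γ ∑ a', π(a' | s') Q(s', a')` with `s'` distributed according to `ℙ(· | s, a)`, or
averaged out (`mean`), so that it is
`c(s, a) + γ ∑ s', ℙ(s' | s, a) ∑ a', π(a' | s') Q(s', a')`. -/
inductive Lookahead
  | random
  | mean

variable {S A : Type*} [MeasurableSpace S]

/-- The costs are (almost surely, uniformly) bounded. -/
def MDP.BoundedCosts (M : MDP S A) : Prop :=
  ∃ C : ℝ, ∀ s a, ∀ᵐ x ∂M.outcome s a, |x.1| ≤ C

variable [Fintype S] [Fintype A]

/-- `∑ a, π(a | s) Q(s, a)`. -/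
def policyValue (π : S → PMF A) (Q : S → A → ℝ) (s : S) : ℝ :=
  ∑ a, (π s a).toReal * Q s a

/-- The random variable, on the probability space `(ℝ × S, M.outcome s a)` of costs and next
states, whose CPT-value is taken at the pair `(s, a)`. -/
def MDP.target (M : MDP S A) (π : S → PMF A) (m : Lookahead) (Q : S → A → ℝ) (s : S) (a : A) :
    ℝ × S → ℝ :=
  match m with
  | .random => fun x => x.1 + M.γ * policyValue π Q x.2
  | .mean => fun x => x.1 + M.γ * ∑ s', (M.trans s a s').toReal * policyValue π Q s'

/-- The CPT-Q-iteration operator `T_π`. -/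
def MDP.cptOperator (M : MDP S A) (U : Preference) (π : S → PMF A) (m : Lookahead)
    (Q : S → A → ℝ) : S → A → ℝ :=
  fun s a => U.value (M.outcome s a) (M.target π m Q s a)

/-- The asynchronous CPT-Q-iteration with learning rates `α` and initial value `Q₀`. A pair
`(s, a)` that is not updated at step `k` has `α k s a = 0`. -/
def MDP.cptIteration (M : MDP S A) (U : Preference) (π : S → PMF A) (m : Lookahead)
    (α : ℕ → S → A → ℝ) (Q₀ : S → A → ℝ) : ℕ → S → A → ℝ
  | 0 => Q₀
  | k + 1 => fun s a =>
      (1 - α k s a) * M.cptIteration U π m α Q₀ k s a +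
        α k s a * U.value (M.outcome s a) (M.target π m (M.cptIteration U π m α Q₀ k) s a)

/-- The conditions on a sequence of learning rates. -/
structure IsLearningRate {S A : Type*} (α : ℕ → S → A → ℝ) : Prop where
  mem_Icc : ∀ k s a, α k s a ∈ Set.Icc (0 : ℝ) 1
  sum_eq_top : ∀ s a, Tendsto (fun n => ∑ k ∈ Finset.range n, α k s a) atTop atTop
  summable_sq : ∀ s a, Summable fun k => α k s a ^ 2

end CPT

end

/-!
Once `Q` is held fixed, the CPT-value of the target is a number, so the iteration carries no
sampling noise: for each outcome of the learning rates it is a deterministic asynchronous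
fixed-point iteration for the contraction `T_π`. The fixed point is Banach's. For convergence, let
`K < 1` be the contraction constant and suppose that `|Q^k - Q*| ≤ B` in all components from some
step on. Each component of the error is then bounded by a sequence that moves a fraction `α_k` of
the way towards `K * B` at step `k`, and since `∑ α_k = ∞` it eventually falls below any bound
larger than `K * B` (`eventually_le_add_of_relaxation`). With finitely many components this improves
`B` to `(K + 1) / 2 * B`, and repeating the improvement drives the error to zero
(`tendsto_of_async_contraction`).
-/

namespace CPT

/-- A sequence that is relaxed towards `b` with step sizes `α k` of divergent sum is eventually
below `b + ε`: as `1 - α k ≤ exp (-α k)`, its excess over `b` is, up to a constant factor, at most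
`exp (-∑ α)`. -/
theorem eventually_le_add_of_relaxation {α d : ℕ → ℝ} {b ε : ℝ} (hε : 0 < ε)
    (hα : ∀ k, α k ≤ 1)
    (hsum : Tendsto (fun n => ∑ k ∈ Finset.range n, α k) atTop atTop)
    (hd : ∀ᶠ k in atTop, d (k + 1) ≤ (1 - α k) * d k + α k * b) :
    ∀ᶠ k in atTop, d k ≤ b + ε := by
  obtain ⟨n, hn⟩ := eventually_atTop.1 hd
  set s : ℕ → ℝ := fun n => ∑ k ∈ Finset.range n, α k with hs
  set C : ℝ := max (d n - b) 0 * Real.exp (s n) with hC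
  have hbound : ∀ k, n ≤ k → d k - b ≤ C * Real.exp (-s k) := by
    intro k hk
    induction k, hk using Nat.le_induction with
    | base =>
      rw [hC, mul_assoc, ← Real.exp_add, add_neg_cancel, Real.exp_zero, mul_one]
      exact le_max_left _ _
    | succ k hk ih =>
      have hC0 : 0 ≤ C := by positivity
      have hstep : s (k + 1) = s k + α k := Finset.sum_range_succ _ _
      calc d (k + 1) - b ≤ (1 - α k) * (d k - b) := by linarith [hn k hk]
        _ ≤ (1 - α k) * (C * Real.exp (-s k)) :=
          mul_le_mul_of_nonneg_left ih (sub_nonneg.2 (hα k))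
        _ ≤ Real.exp (-α k) * (C * Real.exp (-s k)) :=
          mul_le_mul_of_nonneg_right (Real.one_sub_le_exp_neg _) (by positivity)
        _ = C * Real.exp (-s (k + 1)) := by
          rw [hstep, neg_add, Real.exp_add]
          ring
  have hlim : Tendsto (fun k => C * Real.exp (-s k)) atTop (𝓝 0) := by
    simpa using (Real.tendsto_exp_neg_atTop_nhds_zero.comp hsum).const_mul C
  filter_upwards [hlim.eventually_lt_const hε, eventually_ge_atTop n] with k hk hnk
  linarith [hbound k hnk]

/-- Asynchronous relaxed fixed-point iteration of a sup-norm contraction converges to the fixed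
point in each component, provided the step sizes of each component have a divergent sum. -/
theorem tendsto_of_async_contraction {S A : Type*} [Fintype S] [Fintype A]
    {T : (S → A → ℝ) → S → A → ℝ} {K : NNReal} (hT : ContractingWith K T)
    {q : S → A → ℝ} (hq : T q = q) {α : ℕ → S → A → ℝ}
    (hα : ∀ k s a, α k s a ∈ Set.Icc (0 : ℝ) 1)
    (hsum : ∀ s a, Tendsto (fun n => ∑ k ∈ Finset.range n, α k s a) atTop atTop)
    {Q : ℕ → S → A → ℝ}
    (hQ : ∀ k s a, Q (k + 1) s a = (1 - α k s a) * Q k s a + α k s a * T (Q k) s a)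
    (s : S) (a : A) : Tendsto (fun k => Q k s a) atTop (𝓝 (q s a)) := by
  have hK1 : (K : ℝ) < 1 := mod_cast hT.1
  have hK0 : (0 : ℝ) ≤ K := K.2
  have hcoord : ∀ (f g : S → A → ℝ) s a, |f s a - g s a| ≤ dist f g := fun f g s a =>
    (dist_le_pi_dist (f s) (g s) a).trans (dist_le_pi_dist f g s)
  -- One step of the iteration relaxes each error towards a number at most `K * B`.
  have step : ∀ {B : ℝ} {k : ℕ}, 0 ≤ B → (∀ s a, |Q k s a - q s a| ≤ B) → ∀ s a,
      |Q (k + 1) s a - q s a| ≤ (1 - α k s a) * |Q k s a - q s a| + α k s a * (K * B) := by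
    intro B k hB hk s a
    have hdist : dist (Q k) q ≤ B :=
      (dist_pi_le_iff hB).2 fun s => (dist_pi_le_iff hB).2 fun a => hk s a
    have hTB : |T (Q k) s a - q s a| ≤ K * B := by
      calc |T (Q k) s a - q s a| ≤ dist (T (Q k)) (T q) := by
            rw [hq]
            exact hcoord _ _ s a
        _ ≤ K * dist (Q k) q := hT.toLipschitzWith.dist_le_mul _ _
        _ ≤ K * B := mul_le_mul_of_nonneg_left hdist hK0
    have h0 := (hα k s a).1
    have h1 : 0 ≤ 1 - α k s a := sub_nonneg.2 (hα k s a).2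
    calc |Q (k + 1) s a - q s a|
        = |(1 - α k s a) * (Q k s a - q s a) + α k s a * (T (Q k) s a - q s a)| := by
          rw [hQ]
          ring_nf
      _ ≤ (1 - α k s a) * |Q k s a - q s a| + α k s a * |T (Q k) s a - q s a| := by
          refine (abs_add_le _ _).trans_eq ?_
          rw [abs_mul, abs_mul, abs_of_nonneg h0, abs_of_nonneg h1]
      _ ≤ (1 - α k s a) * |Q k s a - q s a| + α k s a * (K * B) := by gcongr
  have improve : ∀ B : ℝ, 0 < B → (∀ᶠ k in atTop, ∀ s a, |Q k s a - q s a| ≤ B) →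
      ∀ᶠ k in atTop, ∀ s a, |Q k s a - q s a| ≤ (K + 1) / 2 * B := by
    intro B hB h
    refine eventually_all.2 fun s => eventually_all.2 fun a => ?_
    have hε : 0 < (1 - (K : ℝ)) / 2 * B := mul_pos (by linarith) hB
    have hmid : (K + 1) / 2 * B = K * B + (1 - (K : ℝ)) / 2 * B := by ring
    rw [hmid]
    refine eventually_le_add_of_relaxation (d := fun k => |Q k s a - q s a|) hε
      (fun k => (hα k s a).2) (hsum s a) ?_
    filter_upwards [h] with k hk using step hB.le hk s a
  obtain ⟨B, hB, hbound⟩ : ∃ B : ℝ, 0 < B ∧ ∀ k s a, |Q k s a - q s a| ≤ B := by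
    have hB : 0 < dist (Q 0) q + 1 := by positivity
    refine ⟨dist (Q 0) q + 1, hB, fun k => ?_⟩
    induction k with
    | zero => exact fun s a => (hcoord _ _ s a).trans (le_add_of_nonneg_right zero_le_one)
    | succ k ih =>
      intro s a
      have h0 := (hα k s a).1
      have h1 : 0 ≤ 1 - α k s a := sub_nonneg.2 (hα k s a).2
      linarith [step hB.le ih s a, mul_le_mul_of_nonneg_left (ih s a) h1,
        mul_le_mul_of_nonneg_left (mul_le_of_le_one_left hB.le hK1.le) h0]
  have hr0 : 0 < ((K : ℝ) + 1) / 2 := by positivity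
  have iter : ∀ n : ℕ, ∀ᶠ k in atTop, ∀ s a, |Q k s a - q s a| ≤ ((K + 1) / 2) ^ n * B := by
    intro n
    induction n with
    | zero => exact Eventually.of_forall fun k s a => by simpa using hbound k s a
    | succ n ih =>
      simpa only [pow_succ', mul_assoc] using improve _ (by positivity) ih
  have hpow : Tendsto (fun n : ℕ => (((K : ℝ) + 1) / 2) ^ n * B) atTop (𝓝 0) := by
    simpa using (tendsto_pow_atTop_nhds_zero_of_lt_one hr0.le (by linarith)).mul_const B
  refine Metric.tendsto_nhds.2 fun ε hε => ?_
  obtain ⟨n, hn⟩ := (hpow.eventually_lt_const hε).exists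
  filter_upwards [iter n] with k hk using (hk s a).trans_lt hn

end CPT

theorem proposition4 {S A : Type*} [Fintype S] [Fintype A] [MeasurableSpace S]
    [MeasurableSingletonClass S] (M : CPT.MDP S A) (U : CPT.Preference) (π : S → PMF A)
    (m : CPT.Lookahead) (hcost : M.BoundedCosts)
    (hcontr : ∃ K : NNReal, ContractingWith K (M.cptOperator U π m))
    {Ω : Type*} [MeasurableSpace Ω] (P : Measure Ω) [IsProbabilityMeasure P]
    (α : ℕ → Ω → S → A → ℝ) (hα : ∀ᵐ ω ∂P, CPT.IsLearningRate (fun k => α k ω))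
    (Q₀ : Ω → S → A → ℝ) :
    ∃ Qstar : S → A → ℝ,
      (∀ Q : S → A → ℝ, M.cptOperator U π m Q = Q ↔ Q = Qstar) ∧
      ∀ᵐ ω ∂P, ∀ s a,
        Tendsto (fun k => M.cptIteration U π m (fun k => α k ω) (Q₀ ω) k s a)
          atTop (𝓝 (Qstar s a)) := by
  obtain ⟨K, hK⟩ := hcontr
  have hfix := hK.fixedPoint_isFixedPt
  refine ⟨ContractingWith.fixedPoint _ hK,
    fun Q => ⟨fun h => hK.fixedPoint_unique h, fun h => h ▸ hfix⟩, ?_⟩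
  filter_upwards [hα] with ω hω s a
  exact CPT.tendsto_of_async_contraction hK hfix hω.mem_Icc hω.sum_eq_top
    (fun _ _ _ => rfl) s a
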